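/- **Setting.** Let $\mathcal G$ be a signed weighted digraph on $\{1,\dots,N\}$ without self-loops, with real weights $a_{ik}$ of arbitrary sign ($a_{ik}\neq 0$ iff there is an edge from $k$ to $i$) and Laplacian $L=\mathrm{diag}\{\sum_k a_{1k},\dots,\sum_k a_{Nk}\}-[a_{ik}]$; put $\boldsymbol L=L\otimes I_m$. All systems $\dot x=f(x,u),\ y=h(x,u)$ have $f$ locally Lipschitz, $h$ continuous, and $u,y$ of the same dimension. A storage function is a differentiable, positive definite, radially unbounded real function $V$ of the state; a system is passive if $\dot V\le u^Ty$, and IFP($\nu$) if $\dot V\le u^Ty-\nu u^Tu$, for some storage function $V$, where $\dot V=DV(x)f(x,u)$ and the inequality holds for all $(x,u)$. The agents $P_i$, $i=1,\dots,N$ (possibly heterogeneous), are affine nonlinear systems $$\dot x_{1i}=f_{1i}(x_{1i})+g_{1i}(x_{1i})u_{1i},\qquad y_{1i}=h_{1i}(x_{1i}),\qquad x_{1i}\in\mathbb R^{n_i},\ u_{1i},y_{1i}\in\mathbb R^m,$$ and $P=\bigoplus_i P_i$. The parallel feedforward compensator (PFC) is $C=\bigoplus_i C_i$ with systems $C_i:\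 \dot x_{ci}=f_{ci}(x_{ci},u_{ci}),\ y_{ci}=h_{ci}(x_{ci},u_{ci})$, $u_{ci},y_{ci}\in\mathbb R^m$, such that along every trajectory on $[0,\infty)$ with continuous input, $y_{ci}(t)\to 0$ whenever $u_{ci}(t)\to 0$ as $t\to\infty$. The closed loop is given by $$u_c=u_1=-y_2,\qquad u_2=y_1+y_c,\qquad y_2=\boldsymbol L u_2 .$$ Equivalently, it is the negative feedback interconnection of $P$ with $\tilde\Sigma_2$, where $\tilde\Sigma_2$, with input $v$ and output $y_2$, is the feedback interconnection $y_2=\boldsymbol L(v+y_c)$, $u_c=-y_2$ of $\boldsymbol L$ and $C$. With external inputs $(e_1,e_2)$ this interconnection reads $u_1=e_1-y_2$, $v=e_2+y_1$; the loop above is the case $e_1=e_2=0$. The closed loop is assumed to be well-posed: for all states and all $(e_1,e_2)$ these equations determine all signals uniquely and continuously, and for $e_1=e_2=0$ every initial state has a unique solution on $[0,\infty)$. **Theorem.** Suppose that each agent $P_i$ is passive, that $\mathcal G$ is weight-balanced ($\sum_k a_{ik}=\sum_k a_{ki}$ for all $i$) and strongly connected, and that $0$ is a simple eigenvalue of $L$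 ($L+L^T$ may be indefinite). Let $r\in\mathbb R$ satisfy $$r\,L^TL+\tfrac12(L+L^T)\ \ge\ 0 ,$$ and let $C$ be IFP($\nu$) with $\nu>r$. Then: 1. the closed loop is passive from $(e_1,e_2)$ to $(y_1,y_2)$, i.e. there is a storage function $V$ of the closed-loop state $(x_1,x_c)$ with $\dot V\le e_1^Ty_1+e_2^Ty_2$ for all states and all external inputs; 2. without external inputs ($e_1=e_2=0$), the agents asymptotically achieve output synchronization: for every initial state, $\lim_{t\to\infty}|y_{1i}(t)-y_{1k}(t)|=0$ for all $i,k$. -/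

import Mathlib

open Filter Topology Set

noncomputable section

namespace PFC

/-! ## Signed weighted digraphs

The graph is given by its weight matrix `A`, where `A i k` is the (possibly negative) weight of the
edge from `k` to `i`; there is such an edge iff `A i k ≠ 0`. -/

/-- The signed Laplacian `diag(in-degrees) - A` (no absolute values in the diagonal). -/
def laplacian {N : ℕ} (A : Matrix (Fin N) (Fin N) ℝ) : Matrix (Fin N) (Fin N) ℝ :=
  Matrix.diagonal (fun i => ∑ k, A i k) - A

/-- In-degree equals out-degree at every node. -/
def WeightBalanced {N : ℕ} (A : Matrix (Fin N) (Fin N) ℝ) : Prop :=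
  ∀ i, ∑ k, A i k = ∑ k, A k i

/-- There is a directed path from every node to every node. -/
def StronglyConnected {N : ℕ} (A : Matrix (Fin N) (Fin N) ℝ) : Prop :=
  ∀ j l, Relation.ReflTransGen (fun k i => A i k ≠ 0) j l

/-- The memoryless coupling `L ⊗ I` acting on stacked signals: `(L u)_i = ∑ k, L i k • u_k`. -/
def coupling {N : ℕ} {E : Type*} [NormedAddCommGroup E] [NormedSpace ℝ E]
    (L : Matrix (Fin N) (Fin N) ℝ) (u : PiLp 2 (fun _ : Fin N => E)) :
    PiLp 2 (fun _ : Fin N => E) :=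
  WithLp.toLp 2 (fun i => ∑ k, L i k • u k)

/-! ## Systems and passivity -/

/-- A nonlinear system `x' = f(x, u)`, `y = h(x, u)` with state space `X` and with inputs and outputs
in `U`, where `f` is locally Lipschitz and `h` is continuous. -/
structure ControlSystem (X U : Type*) [NormedAddCommGroup X] [NormedSpace ℝ X]
    [NormedAddCommGroup U] [InnerProductSpace ℝ U] where
  f : X → U → X
  h : X → U → U
  locallyLipschitz_f : LocallyLipschitz (fun z : X × U => f z.1 z.2)
  continuous_h : Continuous (fun z : X × U => h z.1 z.2)

/-- A storage function: differentiable, positive definite and radially unbounded. -/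
structure IsStorage {X : Type*} [NormedAddCommGroup X] [NormedSpace ℝ X] (V : X → ℝ) : Prop where
  differentiable : Differentiable ℝ V
  map_zero : V 0 = 0
  pos : ∀ x, x ≠ 0 → 0 < V x
  radially_unbounded : Tendsto V (Bornology.cobounded X) atTop

namespace ControlSystem

section
variable {X U : Type*} [NormedAddCommGroup X] [NormedSpace ℝ X]
  [NormedAddCommGroup U] [InnerProductSpace ℝ U]

/-- The system has the affine form `x' = f(x) + g(x) u`, `y = h(x)`. -/
def IsAffine (S : ControlSystem X U) : Prop :=
  ∃ (f : X → X) (g : X → U →L[ℝ] X) (h : X → U),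
    (∀ x u, S.f x u = f x + g x u) ∧ (∀ x u, S.h x u = h x)

/-- IFP(`ν`): `V' ≤ uᵀ y - ν uᵀ u` for some storage function `V` of the state, where
`V' = DV(x) f(x, u)` is the derivative of `V` along the system. -/
def IsIFP (S : ControlSystem X U) (ν : ℝ) : Prop :=
  ∃ V : X → ℝ, IsStorage V ∧
    ∀ x u, fderiv ℝ V x (S.f x u) ≤ inner ℝ u (S.h x u) - ν * inner ℝ u u

/-- Passivity: `V' ≤ uᵀ y` for some storage function `V` of the state. -/
def IsPassive (S : ControlSystem X U) : Prop :=
  ∃ V : X → ℝ, IsStorage V ∧ ∀ x u, fderiv ℝ V x (S.f x u) ≤ inner ℝ u (S.h x u)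

/-- The output vanishes as the input vanishes: along every trajectory on `[0, ∞)`, from any initial
state and with any continuous input `u`, if `u(t) → 0` then `y(t) → 0`. -/
def OutputVanishes (S : ControlSystem X U) : Prop :=
  ∀ (x : ℝ → X) (u : ℝ → U), ContinuousOn u (Ici 0) →
    (∀ t, 0 ≤ t → HasDerivWithinAt x (S.f (x t) (u t)) (Ici 0) t) →
    Tendsto u atTop (𝓝 0) → Tendsto (fun t => S.h (x t) (u t)) atTop (𝓝 0)

end

/-- The direct sum `⨁ S i` (block-diagonal system) of finitely many systems, acting on stacked states,
inputs and outputs with the Euclidean inner product. -/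
def directSum {N : ℕ} {X U : Fin N → Type*}
    [∀ i, NormedAddCommGroup (X i)] [∀ i, NormedSpace ℝ (X i)]
    [∀ i, NormedAddCommGroup (U i)] [∀ i, InnerProductSpace ℝ (U i)]
    (S : ∀ i, ControlSystem (X i) (U i)) : ControlSystem (PiLp 2 X) (PiLp 2 U) where
  f x u := WithLp.toLp 2 (fun i => (S i).f (x i) (u i))
  h x u := WithLp.toLp 2 (fun i => (S i).h (x i) (u i))
  locallyLipschitz_f := by
    have hcomp : ∀ i, LocallyLipschitz
        (fun z : PiLp 2 X × PiLp 2 U => (S i).f (z.1 i) (z.2 i)) := by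
      intro i
      have hX : LipschitzWith 1 (fun x : PiLp 2 X => x i) := by
        have h := (LipschitzWith.eval (α := X) i).comp (PiLp.lipschitzWith_ofLp 2 X)
        rw [one_mul] at h
        exact h
      have hU : LipschitzWith 1 (fun u : PiLp 2 U => u i) := by
        have h := (LipschitzWith.eval (α := U) i).comp (PiLp.lipschitzWith_ofLp 2 U)
        rw [one_mul] at h
        exact h
      exact (S i).locallyLipschitz_f.comp
        ((hX.comp LipschitzWith.prod_fst).locallyLipschitz.prodMk
          (hU.comp LipschitzWith.prod_snd).locallyLipschitz)
    intro z
    choose K t ht hK using fun i => hcomp i z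
    have hpi : LipschitzOnWith (∑ i, K i)
        (fun z : PiLp 2 X × PiLp 2 U => fun i => (S i).f (z.1 i) (z.2 i)) (⋂ i, t i) := by
      intro a ha b hb
      rw [edist_pi_le_iff]
      intro i
      refine (hK i (mem_iInter.1 ha i) (mem_iInter.1 hb i)).trans ?_
      gcongr
      exact Finset.single_le_sum (fun j _ => zero_le (a := K j)) (Finset.mem_univ i)
    exact ⟨_, ⋂ i, t i, Filter.iInter_mem.2 ht,
      (PiLp.lipschitzWith_toLp 2 X).comp_lipschitzOnWith hpi⟩
  continuous_h := by
    refine (PiLp.continuous_toLp 2 U).comp (continuous_pi fun i => ?_)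
    exact (S i).continuous_h.comp
      (((PiLp.continuous_apply 2 X i).comp continuous_fst).prodMk
        ((PiLp.continuous_apply 2 U i).comp continuous_snd))

end ControlSystem

/-! ## The closed loop -/

/-- The internal signals of the closed loop: inputs and outputs of the agents (`u₁`, `y₁`), of the
coupling (`u₂`, `y₂`) and of the compensator (`uc`, `yc`). -/
structure Signals (U : Type*) where
  u₁ : U
  u₂ : U
  uc : U
  y₁ : U
  y₂ : U
  yc : U

section
variable {X₁ Xc U : Type*} [NormedAddCommGroup X₁] [NormedSpace ℝ X₁]
  [NormedAddCommGroup Xc] [NormedSpace ℝ Xc] [NormedAddCommGroup U] [InnerProductSpace ℝ U]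

/-- The agents `P` with the parallel feedforward compensator `C`, in negative feedback with the
memoryless coupling `L`: `uc = u₁`, `u₁ = e₁ - y₂`, `u₂ = e₂ + (y₁ + yc)`, `y₂ = L u₂`. -/
def PFCLoop (P : ControlSystem X₁ U) (C : ControlSystem Xc U) (L : U → U)
    (x₁ : X₁) (xc : Xc) (e₁ e₂ : U) (s : Signals U) : Prop :=
  s.y₁ = P.h x₁ s.u₁ ∧ s.yc = C.h xc s.uc ∧ s.y₂ = L s.u₂ ∧
  s.uc = s.u₁ ∧ s.u₁ = e₁ - s.y₂ ∧ s.u₂ = e₂ + (s.y₁ + s.yc)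

/-- The same loop seen as the negative feedback interconnection of `P` with the compensated coupling,
which is the feedback interconnection of `L` and `C` (`uc = -y₂`, `y₂ = L (v + yc)` for an input `v`):
the external input `e₁` enters at the input `u₁ = e₁ - y₂` of `P`, and `e₂` at the input `v = e₂ + y₁`
of the compensated coupling. -/
def FeedbackLoop (P : ControlSystem X₁ U) (C : ControlSystem Xc U) (L : U → U)
    (x₁ : X₁) (xc : Xc) (e₁ e₂ : U) (s : Signals U) : Prop :=
  s.y₁ = P.h x₁ s.u₁ ∧ s.yc = C.h xc s.uc ∧ s.y₂ = L s.u₂ ∧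
  s.uc = - s.y₂ ∧ s.u₁ = e₁ - s.y₂ ∧ s.u₂ = (e₂ + s.y₁) + s.yc

/-- The two descriptions agree when `e₁ = 0`. -/
theorem pfcLoop_zero_iff_feedbackLoop (P : ControlSystem X₁ U) (C : ControlSystem Xc U) (L : U → U)
    (x₁ : X₁) (xc : Xc) (e₂ : U) (s : Signals U) :
    PFCLoop P C L x₁ xc 0 e₂ s ↔ FeedbackLoop P C L x₁ xc 0 e₂ s := by
  unfold PFCLoop FeedbackLoop
  rw [add_assoc, zero_sub]
  constructor
  · rintro ⟨h1, h2, h3, h4, h5, h6⟩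
    exact ⟨h1, h2, h3, h4.trans h5, h5, h6⟩
  · rintro ⟨h1, h2, h3, h4, h5, h6⟩
    exact ⟨h1, h2, h3, h4.trans h5.symm, h5, h6⟩

/-- A solution on `[0, ∞)` of the closed loop without external inputs. -/
structure IsSolution (P : ControlSystem X₁ U) (C : ControlSystem Xc U) (L : U → U)
    (x₁ : ℝ → X₁) (xc : ℝ → Xc) (s : ℝ → Signals U) : Prop where
  interconnection : ∀ t, 0 ≤ t → PFCLoop P C L (x₁ t) (xc t) 0 0 (s t)
  deriv_agents : ∀ t, 0 ≤ t → HasDerivWithinAt x₁ (P.f (x₁ t) (s t).u₁) (Ici 0) t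
  deriv_compensator : ∀ t, 0 ≤ t → HasDerivWithinAt xc (C.f (xc t) (s t).uc) (Ici 0) t

/-- Well-posedness of the closed loop: the internal signals are determined uniquely by the current
states and external inputs, and depend continuously on them (all of them are continuous once `y₂`
is); and without external inputs there is a unique solution for every initial state. -/
structure WellPosed (P : ControlSystem X₁ U) (C : ControlSystem Xc U) (L : U → U) : Prop where
  existsUnique_signals : ∀ x₁ xc e₁ e₂, ∃! s, FeedbackLoop P C L x₁ xc e₁ e₂ s
  continuous_signals : ∃ κ : (X₁ × Xc) × (U × U) → U, Continuous κ ∧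
    ∀ x₁ xc e₁ e₂ s, FeedbackLoop P C L x₁ xc e₁ e₂ s → s.y₂ = κ ((x₁, xc), (e₁, e₂))
  exists_solution : ∀ a₁ ac, ∃ x₁ xc s, IsSolution P C L x₁ xc s ∧ x₁ 0 = a₁ ∧ xc 0 = ac
  unique_solution : ∀ x₁ xc s x₁' xc' s', IsSolution P C L x₁ xc s → IsSolution P C L x₁' xc' s' →
    x₁ 0 = x₁' 0 → xc 0 = xc' 0 → EqOn x₁ x₁' (Ici 0) ∧ EqOn xc xc' (Ici 0)

/-- Passivity of the closed loop from `(e₁, e₂)` to `(y₁, y₂)`: there is a storage function `V` of the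
closed-loop state with `V' ≤ e₁ᵀ y₁ + e₂ᵀ y₂`. -/
def ClosedLoopPassive (P : ControlSystem X₁ U) (C : ControlSystem Xc U) (L : U → U) : Prop :=
  ∃ V : X₁ × Xc → ℝ, IsStorage V ∧
    ∀ x₁ xc e₁ e₂ s, FeedbackLoop P C L x₁ xc e₁ e₂ s →
      fderiv ℝ V (x₁, xc) (P.f x₁ s.u₁, C.f xc s.uc) ≤ inner ℝ e₁ s.y₁ + inner ℝ e₂ s.y₂

end

end PFC

end

open Filter Topology Set

namespace PFC

/-! ### Storage functions -/

section Storage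

/-! The proof balances a shortage of passivity against an excess. The bound on `r` says that the
coupling `y₂ = L u₂` satisfies `u₂ᵀy₂ ≥ -r|y₂|²`, a shortage measured in its output. The compensator
has input `-y₂`, so its IFP surplus is `ν|y₂|²`. Adding the storage functions of agents and
compensator, the cross terms cancel and leave `V' ≤ e₁ᵀy₁ + e₂ᵀy₂ - (ν - r)|y₂|²`
(`exists_storage_dissipation`). Since `ν > r`, this is passivity.

Without external inputs, `V` decreases, so the state stays in a compact sublevel set. There `y₂` is
a continuous function of the state, hence uniformly continuous in time, and a Barbalat argument
gives `y₂ → 0` (`IsSolution.tendsto_y₂`). The compensator input then vanishes, hence so does `yc`.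
Finally `L u₂ → 0` and the kernel of `L` is the consensus line, so `u₂ = y₁ + yc` synchronizes
(`tendsto_sub_of_tendsto_coupling`), and so does `y₁`. -/

theorem IsStorage.nonneg {X : Type*} [NormedAddCommGroup X] [NormedSpace ℝ X] {V : X → ℝ}
    (hV : IsStorage V) (x : X) : 0 ≤ V x := by
  rcases eq_or_ne x 0 with rfl | hx
  · exact hV.map_zero.ge
  · exact (hV.pos x hx).le

/-- Radial unboundedness bounds the sublevel sets; a decreasing storage function thus traps
trajectories in a compact set. -/
theorem IsStorage.isCompact_sublevel {X : Type*} [NormedAddCommGroup X] [NormedSpace ℝ X]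
    [FiniteDimensional ℝ X] {V : X → ℝ} (hV : IsStorage V) (c : ℝ) :
    IsCompact {x | V x ≤ c} := by
  have : ProperSpace X := FiniteDimensional.proper ℝ X
  refine Metric.isCompact_of_isClosed_isBounded
    (isClosed_le hV.differentiable.continuous continuous_const) ?_
  rw [← Bornology.isCobounded_compl_iff]
  filter_upwards [hV.radially_unbounded.eventually_gt_atTop c] with x hx
  simpa using hx

/-- The sum of two storage functions is a storage function of the pair of states. -/
theorem IsStorage.add {X Y : Type*} [NormedAddCommGroup X] [NormedSpace ℝ X]
    [NormedAddCommGroup Y] [NormedSpace ℝ Y] [FiniteDimensional ℝ X] [FiniteDimensional ℝ Y]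
    {V : X → ℝ} {W : Y → ℝ} (hV : IsStorage V) (hW : IsStorage W) :
    IsStorage (fun z : X × Y => V z.1 + W z.2) where
  differentiable := (hV.differentiable.comp differentiable_fst).add
    (hW.differentiable.comp differentiable_snd)
  map_zero := by simp [hV.map_zero, hW.map_zero]
  pos := by
    rintro ⟨x, y⟩ hxy
    have h1 := hV.nonneg x
    have h2 := hW.nonneg y
    by_cases hx : x = 0
    · have hy : y ≠ 0 := by
        rintro rfl
        exact hxy (by simp [hx])
      linarith [hW.pos y hy]
    · linarith [hV.pos x hx]
  radially_unbounded := by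
    have : ProperSpace X := FiniteDimensional.proper ℝ X
    have : ProperSpace Y := FiniteDimensional.proper ℝ Y
    have hV' := hV.radially_unbounded
    have hW' := hW.radially_unbounded
    rw [Metric.cobounded_eq_cocompact] at hV' hW' ⊢
    -- A pair leaves compact sets only if one of its components does. In either case the other
    -- summand is nonnegative and can be dropped.
    rw [← coprod_cocompact, Filter.coprod, tendsto_sup]
    exact ⟨tendsto_atTop_mono (fun z => le_add_of_nonneg_right (hW.nonneg z.2))
        (hV'.comp tendsto_comap),
      tendsto_atTop_mono (fun z => le_add_of_nonneg_left (hV.nonneg z.1))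
        (hW'.comp tendsto_comap)⟩

/-- The sum of finitely many storage functions is a storage function of the stacked state. -/
theorem IsStorage.sum {N : ℕ} {X : Fin N → Type*} [∀ i, NormedAddCommGroup (X i)]
    [∀ i, NormedSpace ℝ (X i)] [∀ i, FiniteDimensional ℝ (X i)] {V : ∀ i, X i → ℝ}
    (hV : ∀ i, IsStorage (V i)) : IsStorage (fun x : PiLp 2 X => ∑ i, V i (x i)) where
  differentiable := Differentiable.fun_sum fun i _ =>
    (hV i).differentiable.comp (PiLp.proj (𝕜 := ℝ) 2 X i).differentiable
  map_zero := Finset.sum_eq_zero fun i _ => (hV i).map_zero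
  pos := by
    intro x hx
    obtain ⟨i, hi⟩ : ∃ i, x i ≠ 0 := by
      by_contra! h
      exact hx (PiLp.ext h)
    exact Finset.sum_pos' (fun j _ => (hV j).nonneg _) ⟨i, Finset.mem_univ i, (hV i).pos _ hi⟩
  radially_unbounded := by
    have hp : ∀ i, ProperSpace (X i) := fun i => FiniteDimensional.proper ℝ (X i)
    have : ProperSpace (PiLp 2 X) := FiniteDimensional.proper ℝ _
    have key : Tendsto (fun x : ∀ i, X i => ∑ i, V i (x i)) (cocompact _) atTop := by
      rw [← coprodᵢ_cocompact, Filter.coprodᵢ, tendsto_iSup]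
      intro i
      have hVi := (hV i).radially_unbounded
      rw [Metric.cobounded_eq_cocompact] at hVi
      exact tendsto_atTop_mono (fun x => Finset.single_le_sum
        (f := fun j => V j (x j)) (fun j _ => (hV j).nonneg _) (Finset.mem_univ i))
        (hVi.comp tendsto_comap)
    rw [Metric.cobounded_eq_cocompact]
    exact key.comp (PiLp.homeomorph 2 X).isClosedEmbedding.tendsto_cocompact

/-- A direct sum of passive systems is passive. -/
theorem ControlSystem.IsPassive.directSum {N : ℕ} {X U : Fin N → Type*}
    [∀ i, NormedAddCommGroup (X i)] [∀ i, NormedSpace ℝ (X i)] [∀ i, FiniteDimensional ℝ (X i)]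
    [∀ i, NormedAddCommGroup (U i)] [∀ i, InnerProductSpace ℝ (U i)]
    {S : ∀ i, ControlSystem (X i) (U i)} (hS : ∀ i, (S i).IsPassive) :
    (ControlSystem.directSum S).IsPassive := by
  choose V hV hVS using hS
  refine ⟨fun x => ∑ i, V i (x i), IsStorage.sum hV, fun x u => ?_⟩
  have hd : HasFDerivAt (fun x : PiLp 2 X => ∑ i, V i (x i))
      (∑ i, (fderiv ℝ (V i) (x i)).comp (PiLp.proj (𝕜 := ℝ) 2 X i)) x :=
    HasFDerivAt.fun_sum fun i _ =>
      ((hV i).differentiable (x i)).hasFDerivAt.comp x (PiLp.proj (𝕜 := ℝ) 2 X i).hasFDerivAt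
  rw [hd.fderiv, PiLp.inner_apply, _root_.sum_apply]
  exact Finset.sum_le_sum fun i _ => hVS i (x i) (u i)

end Storage

/-! ### The Laplacian coupling -/

section Coupling

open Matrix

theorem coupling_apply_apply {N m : ℕ} (L : Matrix (Fin N) (Fin N) ℝ)
    (u : PiLp 2 (fun _ : Fin N => EuclideanSpace ℝ (Fin m))) (i : Fin N) (j : Fin m) :
    coupling L u i j = (L *ᵥ fun k => u k j) i := by
  simp [coupling, mulVec, dotProduct]

/-- With `coupling_apply_apply`, this splits `L ⊗ I_m` into `m` independent copies of `L`, one per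
signal coordinate. -/
theorem inner_eq_sum_dotProduct {N m : ℕ}
    (u v : PiLp 2 (fun _ : Fin N => EuclideanSpace ℝ (Fin m))) :
    inner ℝ u v = ∑ j, (fun i => u i j) ⬝ᵥ (fun i => v i j) := by
  simp only [PiLp.inner_apply, dotProduct]
  rw [Finset.sum_comm]
  simp [mul_comm]

/-- If `r LᵀL + (L + Lᵀ)/2 ≥ 0` then `L ⊗ I` is input-feedforward passive up to the shortage `r`
measured in its output. -/
theorem inner_coupling_add_nonneg {N m : ℕ} {L : Matrix (Fin N) (Fin N) ℝ} {r : ℝ}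
    (hr : (r • (Lᵀ * L) + (1 / 2 : ℝ) • (L + Lᵀ)).PosSemidef)
    (u : PiLp 2 (fun _ : Fin N => EuclideanSpace ℝ (Fin m))) :
    0 ≤ inner ℝ u (coupling L u) + r * inner ℝ (coupling L u) (coupling L u) := by
  rw [inner_eq_sum_dotProduct, inner_eq_sum_dotProduct, Finset.mul_sum, ← Finset.sum_add_distrib]
  refine Finset.sum_nonneg fun j _ => ?_
  simp only [coupling_apply_apply]
  set w : Fin N → ℝ := fun k => u k j
  have h := hr.dotProduct_mulVec_nonneg w
  have h1 : w ⬝ᵥ (Lᵀ *ᵥ w) = w ⬝ᵥ (L *ᵥ w) := by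
    rw [mulVec_transpose, dotProduct_comm, ← dotProduct_mulVec]
  have h2 : w ⬝ᵥ ((Lᵀ * L) *ᵥ w) = (L *ᵥ w) ⬝ᵥ (L *ᵥ w) := by
    rw [← mulVec_mulVec, dotProduct_mulVec, vecMul_transpose]
  simp only [star_trivial, add_mulVec, smul_mulVec, dotProduct_add, dotProduct_smul, h1, h2,
    smul_eq_mul] at h
  change 0 ≤ w ⬝ᵥ (L *ᵥ w) + r * ((L *ᵥ w) ⬝ᵥ (L *ᵥ w))
  linarith

theorem laplacian_mulVec_one {N : ℕ} (A : Matrix (Fin N) (Fin N) ℝ) :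
    laplacian A *ᵥ 1 = 0 := by
  ext i
  simp [laplacian, mulVec, dotProduct, diagonal_apply]

/-- If `0` is a simple eigenvalue of the Laplacian then its kernel consists of the consensus
vectors. -/
theorem eq_of_laplacian_mulVec_eq_zero {N : ℕ} {A : Matrix (Fin N) (Fin N) ℝ}
    (h : (laplacian A).charpoly.rootMultiplicity 0 = 1) {v : Fin N → ℝ}
    (hv : laplacian A *ᵥ v = 0) (i k : Fin N) : v i = v k := by
  set φ : Module.End ℝ (Fin N → ℝ) := Matrix.toLin' (laplacian A)
  -- Algebraic multiplicity is the dimension of the generalized eigenspace, which contains the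
  -- kernel.
  have hfin : Module.finrank ℝ (φ.maxGenEigenspace 0) ≤ 1 := by
    rw [φ.finrank_maxGenEigenspace_zero_eq, Matrix.charpoly_toLin',
      ← Polynomial.rootMultiplicity_eq_natTrailingDegree', h]
  have hmem : ∀ {w : Fin N → ℝ}, laplacian A *ᵥ w = 0 → w ∈ φ.maxGenEigenspace 0 := by
    intro w hw
    rw [Module.End.mem_maxGenEigenspace]
    exact ⟨1, by simpa [φ] using hw⟩
  obtain ⟨b, hb⟩ := finrank_le_one_iff.1 hfin
  -- The all-ones vector lies on the line spanned by `b`, so `b` is constant, and so is every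
  -- multiple `v` of it.
  obtain ⟨c, hc⟩ := hb ⟨1, hmem (laplacian_mulVec_one A)⟩
  obtain ⟨d, hd⟩ := hb ⟨v, hmem hv⟩
  have hc' : ∀ j, c * (b : Fin N → ℝ) j = 1 := fun j =>
    congrFun (congrArg Subtype.val hc) j
  have hd' : ∀ j, d * (b : Fin N → ℝ) j = v j := fun j =>
    congrFun (congrArg Subtype.val hd) j
  have hc0 : c ≠ 0 := by
    rintro rfl
    simpa using hc' i
  rw [← hd' i, ← hd' k, mul_left_cancel₀ hc0 ((hc' i).trans (hc' k).symm)]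

/-- Differences of nodes lie in the row space of the Laplacian. -/
theorem exists_vecMul_laplacian_eq {N : ℕ} {A : Matrix (Fin N) (Fin N) ℝ}
    (h : (laplacian A).charpoly.rootMultiplicity 0 = 1) (i k : Fin N) :
    ∃ c : Fin N → ℝ, c ᵥ* laplacian A = Pi.single i 1 - Pi.single k 1 := by
  set φ : Module.End ℝ (Fin N → ℝ) := Matrix.toLin' (laplacian A)
  let δ : Module.Dual ℝ (Fin N → ℝ) :=
    LinearMap.proj (R := ℝ) (φ := fun _ => ℝ) i - LinearMap.proj (R := ℝ) (φ := fun _ => ℝ) k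
  -- The row space is the annihilator of the kernel, and `v i - v k` vanishes on consensus vectors.
  have hδ : δ ∈ LinearMap.range φ.dualMap := by
    rw [LinearMap.range_dualMap_eq_dualAnnihilator_ker, Submodule.mem_dualAnnihilator]
    intro v hv
    have : laplacian A *ᵥ v = 0 := by simpa [φ] using hv
    simp [δ, eq_of_laplacian_mulVec_eq_zero h this i k]
  obtain ⟨ψ, hψ⟩ := hδ
  refine ⟨fun j => ψ (Pi.single j 1), funext fun l => ?_⟩
  have hl : ψ (laplacian A *ᵥ Pi.single l 1) = δ (Pi.single l 1) := LinearMap.congr_fun hψ _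
  rw [mulVec_single_one, ψ.pi_apply_eq_sum_univ] at hl
  simp only [δ, LinearMap.sub_apply, LinearMap.proj_apply, smul_eq_mul, col_apply] at hl
  simp only [vecMul, dotProduct, Pi.sub_apply]
  rw [Pi.single_comm i, Pi.single_comm k, ← hl]
  refine Finset.sum_congr rfl fun j _ => ?_
  rw [mul_comm]
  congr 2
  ext j'
  simp [Pi.single_apply, eq_comm]

/-- If the Laplacian coupling of a signal vanishes asymptotically, the signal synchronizes. -/
theorem tendsto_sub_of_tendsto_coupling {N : ℕ} {E : Type*} [NormedAddCommGroup E]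
    [NormedSpace ℝ E] {A : Matrix (Fin N) (Fin N) ℝ}
    (h : (laplacian A).charpoly.rootMultiplicity 0 = 1)
    {α : Type*} {l : Filter α} {y : α → PiLp 2 (fun _ : Fin N => E)}
    (hy : ∀ j, Tendsto (fun t => coupling (laplacian A) (y t) j) l (𝓝 0)) (i k : Fin N) :
    Tendsto (fun t => y t i - y t k) l (𝓝 0) := by
  obtain ⟨c, hc⟩ := exists_vecMul_laplacian_eq h i k
  have key : ∀ t, y t i - y t k = ∑ j, c j • coupling (laplacian A) (y t) j := by
    intro t
    have h1 : ∀ l, ∑ j, c j * laplacian A j l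
        = (Pi.single i (1 : ℝ) : Fin N → ℝ) l - (Pi.single k (1 : ℝ) : Fin N → ℝ) l :=
      fun l => congrFun hc l
    simp only [coupling, Finset.smul_sum, smul_smul]
    rw [Finset.sum_comm]
    simp only [← Finset.sum_smul, h1, sub_smul, Finset.sum_sub_distrib]
    simp [Pi.single_apply]
  simp only [key]
  simpa using tendsto_finsetSum Finset.univ fun j _ => (hy j).const_smul (c j)

end Coupling

/-! ### Dissipation in the closed loop -/

section Loop

variable {X₁ Xc U : Type*} [NormedAddCommGroup X₁] [NormedSpace ℝ X₁]
  [NormedAddCommGroup Xc] [NormedSpace ℝ Xc] [NormedAddCommGroup U] [InnerProductSpace ℝ U]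

/-- The closed loop of a passive system with an IFP-compensated coupling dissipates in `y₂`. -/
theorem exists_storage_dissipation [FiniteDimensional ℝ X₁] [FiniteDimensional ℝ Xc]
    {P : ControlSystem X₁ U} {C : ControlSystem Xc U} {L : U → U} {r ν : ℝ}
    (hP : P.IsPassive) (hC : C.IsIFP ν)
    (hL : ∀ u, 0 ≤ inner ℝ u (L u) + r * inner ℝ (L u) (L u)) :
    ∃ V : X₁ × Xc → ℝ, IsStorage V ∧
      ∀ x₁ xc e₁ e₂ s, FeedbackLoop P C L x₁ xc e₁ e₂ s →
        fderiv ℝ V (x₁, xc) (P.f x₁ s.u₁, C.f xc s.uc) ≤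
          inner ℝ e₁ s.y₁ + inner ℝ e₂ s.y₂ - (ν - r) * ‖s.y₂‖ ^ 2 := by
  obtain ⟨V, hV, hVP⟩ := hP
  obtain ⟨W, hW, hWC⟩ := hC
  refine ⟨fun z => V z.1 + W z.2, hV.add hW, ?_⟩
  rintro x₁ xc e₁ e₂ ⟨u₁, u₂, uc, y₁, y₂, yc⟩ ⟨h1, h2, h3, h4, h5, h6⟩
  dsimp only at *
  have hd : HasFDerivAt (fun z : X₁ × Xc => V z.1 + W z.2)
      ((fderiv ℝ V x₁).comp (ContinuousLinearMap.fst ℝ X₁ Xc)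
        + (fderiv ℝ W xc).comp (ContinuousLinearMap.snd ℝ X₁ Xc)) (x₁, xc) :=
    ((hV.differentiable x₁).hasFDerivAt.comp (x₁, xc) hasFDerivAt_fst).add
      ((hW.differentiable xc).hasFDerivAt.comp (x₁, xc) hasFDerivAt_snd)
  have hp := hVP x₁ u₁
  have hc := hWC xc uc
  have hl := hL u₂
  rw [hd.fderiv]
  change fderiv ℝ V x₁ (P.f x₁ u₁) + fderiv ℝ W xc (C.f xc uc) ≤ _
  rw [← h1] at hp
  rw [← h2] at hc
  rw [← h3] at hl
  have hu : inner ℝ u₂ y₂ = inner ℝ e₂ y₂ + inner ℝ y₂ y₁ + inner ℝ y₂ yc := by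
    rw [h6, inner_add_left, inner_add_left, real_inner_comm y₂ y₁, real_inner_comm y₂ yc]
  have hp' : inner ℝ u₁ y₁ = inner ℝ e₁ y₁ - inner ℝ y₂ y₁ := by rw [h5, inner_sub_left]
  have hc' : inner ℝ uc yc = - inner ℝ y₂ yc := by rw [h4, inner_neg_left]
  have hn : inner ℝ uc uc = ‖y₂‖ ^ 2 := by rw [h4, inner_neg_neg, real_inner_self_eq_norm_sq]
  rw [real_inner_self_eq_norm_sq] at hl
  rw [hc', hn] at hc
  -- Sum of `hp`, `hc` and `hl`: the terms `y₂ᵀy₁` and `y₂ᵀyc` cancel.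
  linarith

end Loop

/-! ### Barbalat-type convergence -/

/-- A uniformly continuous signal whose square is dominated by the decay rate of a nonnegative
function vanishes asymptotically. -/
theorem tendsto_zero_of_dissipation {E : Type*} [NormedAddCommGroup E] {y : ℝ → E} {W W' : ℝ → ℝ}
    {c : ℝ} (hc : 0 < c) (hW : ∀ t, 0 ≤ t → 0 ≤ W t)
    (hW' : ∀ t, 0 ≤ t → HasDerivWithinAt W (W' t) (Ici 0) t)
    (hdiss : ∀ t, 0 ≤ t → W' t ≤ - (c * ‖y t‖ ^ 2)) (hy : UniformContinuousOn y (Ici 0)) :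
    Tendsto y atTop (𝓝 0) := by
  have hderiv : ∀ t, 0 < t → HasDerivAt W (W' t) t := fun t ht =>
    (hW' t ht.le).hasDerivAt (Ici_mem_nhds ht)
  have hcont : ContinuousOn W (Ici 0) := fun t ht => (hW' t ht).continuousWithinAt
  have hdecay : ∀ (a b K : ℝ), 0 ≤ a → a ≤ b → (∀ t ∈ Ioo a b, W' t ≤ K) →
      W b - W a ≤ K * (b - a) := by
    intro a b K ha hab hK
    refine (convex_Icc a b).image_sub_le_mul_sub_of_deriv_le
      (hcont.mono fun t ht => ha.trans ht.1) ?_ ?_ a (left_mem_Icc.2 hab) b (right_mem_Icc.2 hab) hab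
    · rw [interior_Icc]
      exact fun t ht => (hderiv t (ha.trans_lt ht.1)).differentiableAt.differentiableWithinAt
    · rw [interior_Icc]
      intro t ht
      rw [(hderiv t (ha.trans_lt ht.1)).deriv]
      exact hK t ht
  -- Freezing `W` at `W 0` for negative times makes it monotone on all of `ℝ`.
  have hanti : Antitone fun t => W (max t 0) := by
    intro a b hab
    have hab' : max a 0 ≤ max b 0 := max_le_max_right 0 hab
    have := hdecay (max a 0) (max b 0) 0 (le_max_right _ _) hab' fun t ht =>
      (hdiss t ((le_max_right _ _).trans ht.1.le)).trans (neg_nonpos.2 (by positivity))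
    simp only
    linarith
  have hbdd : BddBelow (range fun t => W (max t 0)) :=
    ⟨0, by rintro _ ⟨t, rfl⟩; exact hW _ (le_max_right _ _)⟩
  have hlim := tendsto_atTop_ciInf hanti hbdd
  rw [Metric.tendsto_nhds]
  intro ε hε
  obtain ⟨δ, hδ, hyδ⟩ := Metric.uniformContinuousOn_iff.1 hy (ε / 2) (half_pos hε)
  have hshift : Tendsto (fun t => W (max t 0) - W (max (t + δ) 0)) atTop (𝓝 0) := by
    simpa using hlim.sub (hlim.comp (tendsto_atTop_add_const_right atTop δ tendsto_id))
  -- If `‖y t‖ ≥ ε`, then `‖y‖ ≥ ε / 2` on `(t, t + δ)`, so `W` loses at least this amount there.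
  -- Convergence of `W` excludes that for large `t`.
  have hpos : 0 < c * (ε / 2) ^ 2 * δ := by positivity
  filter_upwards [hshift.eventually_lt_const hpos, eventually_ge_atTop 0] with t ht ht0
  rw [max_eq_left ht0, max_eq_left (by linarith : 0 ≤ t + δ)] at ht
  rw [dist_zero_right]
  by_contra! hbig
  have := hdecay t (t + δ) (-(c * (ε / 2) ^ 2)) ht0 (by linarith) fun τ hτ => by
    have hτ0 : 0 ≤ τ := ht0.trans hτ.1.le
    have hdist := hyδ t ht0 τ hτ0 (by
      rw [Real.dist_eq, abs_sub_comm, abs_of_pos (by linarith [hτ.1])]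
      linarith [hτ.2])
    have hnorm : ε / 2 ≤ ‖y τ‖ := by
      rw [dist_eq_norm] at hdist
      linarith [norm_sub_norm_le (y t) (y τ)]
    refine (hdiss τ hτ0).trans (neg_le_neg ?_)
    gcongr
  have e : t + δ - t = δ := by ring
  rw [e] at this
  linarith

/-- A trajectory in a compact set, driven by a continuous vector field, is uniformly continuous. -/
theorem uniformContinuousOn_of_hasDerivWithinAt {Z : Type*} [NormedAddCommGroup Z]
    [NormedSpace ℝ Z] {z : ℝ → Z} {F : Z → Z} (hF : Continuous F) {K : Set Z} (hK : IsCompact K)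
    (hz : ∀ t, 0 ≤ t → HasDerivWithinAt z (F (z t)) (Ici 0) t) (hzK : MapsTo z (Ici 0) K) :
    UniformContinuousOn z (Ici 0) := by
  obtain ⟨M, hM⟩ := hK.exists_bound_of_continuousOn hF.continuousOn
  have hM' : ∀ t ∈ Ici (0 : ℝ), ‖F (z t)‖₊ ≤ M.toNNReal := fun t ht =>
    NNReal.coe_le_coe.1 ((hM _ (hzK ht)).trans (Real.le_coe_toNNReal M))
  exact ((convex_Ici 0).lipschitzOnWith_of_nnnorm_hasDerivWithin_le hz hM').uniformContinuousOn

/-! ### Asymptotics of the unforced closed loop -/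

section Loop

variable {X₁ Xc U : Type*} [NormedAddCommGroup X₁] [NormedSpace ℝ X₁]
  [NormedAddCommGroup Xc] [NormedSpace ℝ Xc] [NormedAddCommGroup U] [InnerProductSpace ℝ U]

/-- In the unforced closed loop, the output of the coupling is continuous and vanishes
asymptotically, if the loop strictly dissipates in it. -/
theorem IsSolution.tendsto_y₂ [FiniteDimensional ℝ X₁] [FiniteDimensional ℝ Xc]
    {P : ControlSystem X₁ U} {C : ControlSystem Xc U} {L : U → U} {V : X₁ × Xc → ℝ}
    {c : ℝ} (hc : 0 < c) (hwp : WellPosed P C L) (hV : IsStorage V)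
    (hdiss : ∀ x₁ xc s, FeedbackLoop P C L x₁ xc 0 0 s →
      fderiv ℝ V (x₁, xc) (P.f x₁ s.u₁, C.f xc s.uc) ≤ - (c * ‖s.y₂‖ ^ 2))
    {x₁ : ℝ → X₁} {xc : ℝ → Xc} {s : ℝ → Signals U} (hs : IsSolution P C L x₁ xc s) :
    ContinuousOn (fun t => (s t).y₂) (Ici 0) ∧ Tendsto (fun t => (s t).y₂) atTop (𝓝 0) := by
  obtain ⟨κ, hκ, hκs⟩ := hwp.continuous_signals
  have hloop : ∀ t, 0 ≤ t → FeedbackLoop P C L (x₁ t) (xc t) 0 0 (s t) := fun t ht =>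
    (pfcLoop_zero_iff_feedbackLoop ..).1 (hs.interconnection t ht)
  -- `k` is `y₂` as state feedback. As `u₁ = uc = -y₂` without external inputs, the loop becomes the
  -- autonomous system `z' = F z`.
  let k : X₁ × Xc → U := fun z => κ (z, (0, 0))
  let F : X₁ × Xc → X₁ × Xc := fun z => (P.f z.1 (-k z), C.f z.2 (-k z))
  let z : ℝ → X₁ × Xc := fun t => (x₁ t, xc t)
  have hk : Continuous k := hκ.comp (continuous_id.prodMk continuous_const)
  have hF : Continuous F :=
    (P.locallyLipschitz_f.continuous.comp (continuous_fst.prodMk hk.neg)).prodMk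
      (C.locallyLipschitz_f.continuous.comp (continuous_snd.prodMk hk.neg))
  have hy : ∀ t, 0 ≤ t → (s t).y₂ = k (z t) := fun t ht => hκs _ _ _ _ _ (hloop t ht)
  have hFz : ∀ t, 0 ≤ t → F (z t) = (P.f (x₁ t) (s t).u₁, C.f (xc t) (s t).uc) := by
    intro t ht
    obtain ⟨-, -, -, h4, h5, -⟩ := hloop t ht
    rw [h5, h4, zero_sub, hy t ht]
  have hz : ∀ t, 0 ≤ t → HasDerivWithinAt z (F (z t)) (Ici 0) t := by
    intro t ht
    rw [hFz t ht]
    exact (hs.deriv_agents t ht).prodMk (hs.deriv_compensator t ht)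
  have hVz : ∀ t, 0 ≤ t →
      HasDerivWithinAt (V ∘ z) (fderiv ℝ V (z t) (F (z t))) (Ici 0) t := fun t ht =>
    (hV.differentiable (z t)).hasFDerivAt.comp_hasDerivWithinAt t (hz t ht)
  have hVz' : ∀ t, 0 ≤ t → fderiv ℝ V (z t) (F (z t)) ≤ -(c * ‖k (z t)‖ ^ 2) := by
    intro t ht
    rw [hFz t ht, ← hy t ht]
    exact hdiss _ _ _ (hloop t ht)
  have hbound : MapsTo z (Ici 0) {w | V w ≤ V (z 0)} := by
    intro t ht
    have h := (convex_Ici (0 : ℝ)).image_sub_le_mul_sub_of_deriv_le (f := V ∘ z) (C := 0)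
      (fun τ hτ => (hVz τ hτ).continuousWithinAt)
      (fun τ hτ => ((hVz τ (interior_subset hτ)).mono interior_subset).differentiableWithinAt)
      (fun τ hτ => by
        rw [interior_Ici] at hτ
        rw [((hVz τ hτ.le).hasDerivAt (Ici_mem_nhds hτ)).deriv]
        exact (hVz' τ hτ.le).trans (neg_nonpos.2 (by positivity))) 0 self_mem_Ici t ht ht
    simpa using h
  have hK := hV.isCompact_sublevel (V (z 0))
  have huc : UniformContinuousOn (k ∘ z) (Ici 0) :=
    (hK.uniformContinuousOn_of_continuous hk.continuousOn).comp
      (uniformContinuousOn_of_hasDerivWithinAt hF hK hz hbound) hbound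
  have hlim : Tendsto (k ∘ z) atTop (𝓝 0) :=
    tendsto_zero_of_dissipation hc (fun t _ => hV.nonneg (z t)) hVz hVz' huc
  exact ⟨huc.continuousOn.congr fun t ht => hy t ht,
    hlim.congr' ((eventually_ge_atTop 0).mono fun t ht => (hy t ht).symm)⟩

end Loop

theorem ControlSystem.OutputVanishes.directSum {N : ℕ} {X U : Fin N → Type*}
    [∀ i, NormedAddCommGroup (X i)] [∀ i, NormedSpace ℝ (X i)]
    [∀ i, NormedAddCommGroup (U i)] [∀ i, InnerProductSpace ℝ (U i)]
    {S : ∀ i, ControlSystem (X i) (U i)} (hS : ∀ i, (S i).OutputVanishes) :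
    (ControlSystem.directSum S).OutputVanishes := by
  intro x u hu hx hlim
  have key : ∀ i, Tendsto (fun t => (S i).h (x t i) (u t i)) atTop (𝓝 0) := by
    intro i
    refine hS i (fun t => x t i) (fun t => u t i)
      ((PiLp.continuous_apply 2 U i).comp_continuousOn hu) (fun t ht => ?_) ?_
    · exact (PiLp.proj (𝕜 := ℝ) 2 X i).hasFDerivAt.comp_hasDerivWithinAt t (hx t ht)
    · exact ((PiLp.continuous_apply 2 U i).tendsto 0).comp hlim
  exact ((PiLp.continuous_toLp 2 U).tendsto 0).comp (tendsto_pi_nhds.2 key)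

end PFC

theorem mainTheorem4
    {N m : ℕ} {n nc : Fin N → ℕ}
    (A : Matrix (Fin N) (Fin N) ℝ) (hloop : ∀ i, A i i = 0)
    (hbal : PFC.WeightBalanced A) (hconn : PFC.StronglyConnected A)
    (hsimple : (PFC.laplacian A).charpoly.rootMultiplicity 0 = 1)
    (r : ℝ)
    (hr : (r • ((PFC.laplacian A).transpose * PFC.laplacian A)
      + (1 / 2 : ℝ) • (PFC.laplacian A + (PFC.laplacian A).transpose)).PosSemidef)
    (P : ∀ i, PFC.ControlSystem (EuclideanSpace ℝ (Fin (n i))) (EuclideanSpace ℝ (Fin m)))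
    (hP_affine : ∀ i, (P i).IsAffine) (hP : ∀ i, (P i).IsPassive)
    (C : ∀ i, PFC.ControlSystem (EuclideanSpace ℝ (Fin (nc i))) (EuclideanSpace ℝ (Fin m)))
    (hC : ∀ i, (C i).OutputVanishes)
    (ν : ℝ) (hν : r < ν) (hC_ifp : (PFC.ControlSystem.directSum C).IsIFP ν)
    (hwp : PFC.WellPosed (PFC.ControlSystem.directSum P) (PFC.ControlSystem.directSum C)
      (PFC.coupling (PFC.laplacian A))) :
    PFC.ClosedLoopPassive (PFC.ControlSystem.directSum P) (PFC.ControlSystem.directSum C)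
      (PFC.coupling (PFC.laplacian A)) ∧
    ∀ x₁ xc s, PFC.IsSolution (PFC.ControlSystem.directSum P) (PFC.ControlSystem.directSum C)
      (PFC.coupling (PFC.laplacian A)) x₁ xc s →
      ∀ i k, Tendsto (fun t => ‖(s t).y₁ i - (s t).y₁ k‖) atTop (𝓝 0) := by
  obtain ⟨V, hV, hdiss⟩ := PFC.exists_storage_dissipation
    (PFC.ControlSystem.IsPassive.directSum hP) hC_ifp (PFC.inner_coupling_add_nonneg hr)
  have hgap : 0 < ν - r := sub_pos.2 hν
  refine ⟨⟨V, hV, fun x₁ xc e₁ e₂ s hs => (hdiss x₁ xc e₁ e₂ s hs).trans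
    (sub_le_self _ (by positivity))⟩, fun x₁ xc s hs i k => ?_⟩
  obtain ⟨hcont, hlim⟩ := PFC.IsSolution.tendsto_y₂ hgap hwp hV
    (fun x₁ xc s h => by simpa using hdiss x₁ xc 0 0 s h) hs
  have huc : ∀ t, 0 ≤ t → (s t).uc = -(s t).y₂ := by
    intro t ht
    obtain ⟨-, -, -, h4, h5, -⟩ := hs.interconnection t ht
    rw [h4, h5, zero_sub]
  have hyc : Tendsto (fun t => (s t).yc) atTop (𝓝 0) := by
    refine (PFC.ControlSystem.OutputVanishes.directSum hC xc (fun t => (s t).uc)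
      (hcont.neg.congr huc) hs.deriv_compensator ?_).congr' ?_
    · simpa using hlim.neg.congr' ((eventually_ge_atTop 0).mono fun t ht => (huc t ht).symm)
    · exact (eventually_ge_atTop 0).mono fun t ht => (hs.interconnection t ht).2.1.symm
  have hu₂ := PFC.tendsto_sub_of_tendsto_coupling hsimple (l := atTop) (y := fun t => (s t).u₂)
    (fun j => (((PiLp.continuous_apply 2 _ j).tendsto 0).comp hlim).congr'
      ((eventually_ge_atTop 0).mono fun t ht =>
        congrArg (fun w => w j) (hs.interconnection t ht).2.2.1)) i k
  have hyc_diff : Tendsto (fun t => (s t).yc i - (s t).yc k) atTop (𝓝 0) := by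
    simpa using (((PiLp.continuous_apply 2 _ i).tendsto 0).comp hyc).sub
      (((PiLp.continuous_apply 2 _ k).tendsto 0).comp hyc)
  -- `y₁ = u₂ - yc`, because `e₂ = 0`.
  have hy₁ := hu₂.sub hyc_diff
  rw [sub_zero] at hy₁
  rw [← tendsto_zero_iff_norm_tendsto_zero]
  refine hy₁.congr' ((eventually_ge_atTop 0).mono fun t ht => ?_)
  rw [(hs.interconnection t ht).2.2.2.2.2]
  simp only [zero_add, PiLp.add_apply]
  abel
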